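/- Let $G$ be a finite group and $H\le G$ a subgroup. **Definitions.** A $G$-ring is a commutative ring with an action of $G$ by ring automorphisms. An ideal $I$ of a $G$-ring $R$ is *$G$-prime* if $g(I)\subseteq I$ for all $g\in G$, $I\ne R$, and whenever $x\notin I$ and $y\notin I$ there is $g\in G$ with $x\cdot gy\notin I$; the $G$-ring $R$ is *domain-like* if its zero ideal is $G$-prime. For an $H$-ring $R$, $\mathrm{CoInd}_H^G R$ is the $G$-ring of functions $\varphi\colon G\to R$ with $\varphi(hx)=h\varphi(x)$ for all $h\in H$, $x\in G$, with pointwise operations and $(g\varphi)(x)=\varphi(xg)$. A *$G$-Tambara functor* $R$ assigns to each finite $G$-set $X$ a commutative ring $R(X)$ and to each equivariant map $f\colon X\to Y$ a ring homomorphism (restriction) $R(Y)\to R(X)$, an additive homomorphism (transfer) $R(X)\to R(Y)$ and a multiplicative homomorphism (norm) $R(X)\to R(Y)$, all functorial, such that $R$ takes finite disjoint unions to products, transfers and norms commute with restrictions along pullback squares, and norms distribute over transfers along exponential diagrams. A *Tambara ideal* $I$ of $R$ is a family of ideals $I(G/K)\subseteq R(G/K)$, $K\le G$, closed under restrictions,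 transfers and norms along all equivariant maps $G/K\to G/L$ (equivalently: under the restrictions, transfers and norms along the projections $G/K\to G/L$, $K\le L$, and under conjugations). The product $I\cdot J$ of two Tambara ideals is the smallest Tambara ideal that contains $I(G/K)\cdot J(G/K)$ for all $K\le G$. A Tambara ideal $\mathfrak p$ is *prime* if it is not all of $R$ and $I\cdot J\subseteq\mathfrak p$ implies $I\subseteq\mathfrak p$ or $J\subseteq\mathfrak p$ for all Tambara ideals $I,J$; $R$ is *domain-like* if its zero ideal is prime. For an $H$-Tambara functor $R$, $\mathrm{CoInd}_H^G R$ is the $G$-Tambara functor $X\mapsto R(\mathrm{Res}_H^G X)$, where $\mathrm{Res}_H^G X$ is the underlying $H$-set of $X$. **Proposition.** 1. For every $H$-ring $R$, the $G$-ring $\mathrm{CoInd}_H^G R$ is domain-like if and only if the $H$-ring $R$ is domain-like. 2. For every $H$-Tambara functor $R$, the $G$-Tambara functor $\mathrm{CoInd}_H^G R$ is domain-like if and only if the $H$-Tambara functor $R$ is domain-like. -/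

import Mathlib

universe u v w

/-! ### Equivariant rings -/

/-- For a group `G` and a commutative ring `R` with an action of `G` by ring automorphisms (a
`G`-ring), an ideal `I` is `G`-prime if it is `G`-invariant, proper, and whenever `x ∉ I` and
`y ∉ I` there is some `g : G` with `x * (g • y) ∉ I`. -/
structure IsGPrime (G : Type u) [Group G] {R : Type v} [CommRing R] [MulSemiringAction G R]
    (I : Ideal R) : Prop where
  smul_mem : ∀ (g : G) (x : R), x ∈ I → g • x ∈ I
  ne_top : I ≠ ⊤
  exists_mul_smul_notMem : ∀ x y : R, x ∉ I → y ∉ I → ∃ g : G, x * (g • y) ∉ I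

/-- A `G`-ring is domain-like if its zero ideal is `G`-prime. -/
def IsDomainLikeRing (G : Type u) [Group G] (R : Type v) [CommRing R]
    [MulSemiringAction G R] : Prop :=
  IsGPrime G (⊥ : Ideal R)

/-- The coinduction of an `H`-ring `R` to `G`: the ring of left `H`-equivariant maps `G → R` under
pointwise operations. -/
def coindRing {G : Type u} [Group G] (H : Subgroup G) (R : Type v) [CommRing R]
    [MulSemiringAction H R] : Subring (G → R) where
  carrier := {φ | ∀ (h : H) (x : G), φ ((h : G) * x) = h • φ x}
  mul_mem' {a b} ha hb h x := by
    rw [Pi.mul_apply, Pi.mul_apply, ha h x, hb h x, smul_mul']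
  one_mem' h x := by simp
  add_mem' {a b} ha hb h x := by
    rw [Pi.add_apply, Pi.add_apply, ha h x, hb h x, smul_add]
  zero_mem' h x := by simp
  neg_mem' {a} ha h x := by
    rw [Pi.neg_apply, Pi.neg_apply, ha h x, smul_neg]

/-- `G` acts on the coinduction by right translation: `(g • φ) x = φ (x * g)`. -/
instance coindRing.instMulSemiringAction {G : Type u} [Group G] (H : Subgroup G) (R : Type v)
    [CommRing R] [MulSemiringAction H R] : MulSemiringAction G (coindRing H R) where
  smul g φ := ⟨fun x => φ.1 (x * g), fun h x => by
    have := φ.2 h (x * g)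
    rwa [← mul_assoc] at this⟩
  one_smul φ := Subtype.ext (funext fun x => congrArg φ.1 (mul_one x))
  mul_smul g k φ := Subtype.ext (funext fun x => congrArg φ.1 (mul_assoc x g k).symm)
  smul_zero _ := rfl
  smul_add _ _ _ := rfl
  smul_one _ := rfl
  smul_mul _ _ _ := rfl

/-! ### Finite `G`-sets -/

/-- A finite `G`-set. Maps of finite `G`-sets are the equivariant maps `X →[G] Y`. -/
structure FinGSet (G : Type u) [Group G] where
  carrier : Type u
  [action : MulAction G carrier]
  [finite : Finite carrier]

namespace FinGSet

instance (G : Type u) [Group G] : CoeSort (FinGSet G) (Type u) := ⟨FinGSet.carrier⟩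

attribute [instance] FinGSet.action FinGSet.finite

/-- The transitive `G`-set `G ⧸ K`. -/
def orbit {G : Type u} [Group G] [Finite G] (K : Subgroup G) : FinGSet G where
  carrier := G ⧸ K

/-- The empty `G`-set. -/
def empty (G : Type u) [Group G] : FinGSet G where
  carrier := PEmpty.{u + 1}
  action :=
    { smul := fun _ x => x
      one_smul := fun _ => rfl
      mul_smul := fun _ _ _ => rfl }

/-- The underlying `H`-set of a finite `G`-set. -/
def restrict {G : Type u} [Group G] (H : Subgroup G) (X : FinGSet G) : FinGSet H where
  carrier := X

/-- A map of `G`-sets, viewed as a map of `H`-sets. -/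
def restrictHom {G : Type u} [Group G] (H : Subgroup G) {X Y : FinGSet G} (f : X →[G] Y) :
    X.restrict H →[H] Y.restrict H where
  toFun x := f x
  map_smul' h x := f.map_smul (h : G) x

end FinGSet

/-- The square of maps of sets with `a : W → X`, `b : W → Y`, `f : X → Z`, `g : Y → Z` is a pullback
square: it commutes and `W` maps bijectively to the fibre product of `X` and `Y` over `Z`. -/
def IsPullbackSquare {W X Y Z : Type u} (a : W → X) (b : W → Y) (f : X → Z) (g : Y → Z) : Prop :=
  (∀ t, f (a t) = g (b t)) ∧ ∀ x y, f x = g y → ∃! t, a t = x ∧ b t = y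

/-- The diagram
```
  X <--p-- A <--e-- B
  |                 |
  f                 f'
  v                 v
  Y <------q------- P
```
is an exponential diagram, i.e. it is isomorphic to the diagram in which `P` is the dependent
product of `p` along `f` (the set of pairs `(y, s)` of a point `y` of `Y` and a section `s` of `p`
over `f ⁻¹ {y}`), `q (y, s) = y`, `B` is the fibre product of `X` and `P` over `Y`, and
`e (x, (y, s)) = s x`. For diagrams of `G`-sets and equivariant maps the bijection between `P` and
this set of pairs is automatically equivariant for the action `(g • s) x = g • s (g⁻¹ • x)`. -/
structure IsExponentialDiagram {A B P X Y : Type u} (p : A → X) (f : X → Y) (e : B → A)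
    (f' : B → P) (q : P → Y) : Prop where
  pullback : IsPullbackSquare (fun b => p (e b)) f' f q
  existsUnique_of_section : ∀ (y : Y) (s : {x : X // f x = y} → A), (∀ x, p (s x) = x) →
    ∃! z : P, q z = y ∧ ∀ (b : B) (x : {x : X // f x = y}), f' b = z → p (e b) = x → e b = s x

/-! ### Tambara functors -/

/-- A `G`-Tambara functor, defined on all finite `G`-sets: each map `f : X → Y` of finite `G`-sets
has a restriction `res f : R Y → R X`, a transfer `tr f : R X → R Y` and a norm
`nm f : R X → R Y`. -/
structure TambaraFunctor (G : Type u) [Group G] where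
  obj : FinGSet G → Type w
  [commRing : ∀ X, CommRing (obj X)]
  res : ∀ {X Y : FinGSet G}, (X →[G] Y) → (obj Y →+* obj X)
  tr : ∀ {X Y : FinGSet G}, (X →[G] Y) → (obj X →+ obj Y)
  nm : ∀ {X Y : FinGSet G}, (X →[G] Y) → (obj X →* obj Y)
  res_id : ∀ (X : FinGSet G) (a : obj X), res (MulActionHom.id G (X := X)) a = a
  tr_id : ∀ (X : FinGSet G) (a : obj X), tr (MulActionHom.id G (X := X)) a = a
  nm_id : ∀ (X : FinGSet G) (a : obj X), nm (MulActionHom.id G (X := X)) a = a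
  res_comp : ∀ {X Y Z : FinGSet G} (g : Y →[G] Z) (f : X →[G] Y) (a : obj Z),
    res (g.comp f) a = res f (res g a)
  tr_comp : ∀ {X Y Z : FinGSet G} (g : Y →[G] Z) (f : X →[G] Y) (a : obj X),
    tr (g.comp f) a = tr g (tr f a)
  nm_comp : ∀ {X Y Z : FinGSet G} (g : Y →[G] Z) (f : X →[G] Y) (a : obj X),
    nm (g.comp f) a = nm g (nm f a)
  /-- The empty `G`-set is sent to the zero ring. -/
  subsingleton_of_isEmpty : ∀ X : FinGSet G, IsEmpty X → Subsingleton (obj X)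
  /-- Disjoint unions are sent to products. -/
  bijective_of_coproduct : ∀ {X Y Z : FinGSet G} (i : X →[G] Z) (j : Y →[G] Z),
    Function.Bijective (Sum.elim i j) →
      Function.Bijective (fun c : obj Z => (res i c, res j c))
  res_tr : ∀ {W X Y Z : FinGSet G} (a : W →[G] X) (b : W →[G] Y) (f : X →[G] Z) (g : Y →[G] Z),
    IsPullbackSquare a b f g → ∀ c : obj X, res g (tr f c) = tr b (res a c)
  res_nm : ∀ {W X Y Z : FinGSet G} (a : W →[G] X) (b : W →[G] Y) (f : X →[G] Z) (g : Y →[G] Z),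
    IsPullbackSquare a b f g → ∀ c : obj X, res g (nm f c) = nm b (res a c)
  /-- The distributive law: the norm of a transfer along an exponential diagram. -/
  nm_tr : ∀ {A B P X Y : FinGSet G} (p : A →[G] X) (f : X →[G] Y) (e : B →[G] A)
    (f' : B →[G] P) (q : P →[G] Y), IsExponentialDiagram p f e f' q →
      ∀ c : obj A, nm f (tr p c) = tr q (nm f' (res e c))

namespace TambaraFunctor

attribute [instance] TambaraFunctor.commRing

/-- The coinduction of an `H`-Tambara functor to `G`, given by `(CoInd R) X = R (Res X)`; this is
the right adjoint of the restriction functor from `G`-Tambara functors to `H`-Tambara functors. -/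
def coind {G : Type u} [Group G] (H : Subgroup G) (R : TambaraFunctor.{u, w} H) :
    TambaraFunctor.{u, w} G where
  obj X := R.obj (X.restrict H)
  res f := R.res (FinGSet.restrictHom H f)
  tr f := R.tr (FinGSet.restrictHom H f)
  nm f := R.nm (FinGSet.restrictHom H f)
  res_id X := R.res_id (X.restrict H)
  tr_id X := R.tr_id (X.restrict H)
  nm_id X := R.nm_id (X.restrict H)
  res_comp g f := R.res_comp (FinGSet.restrictHom H g) (FinGSet.restrictHom H f)
  tr_comp g f := R.tr_comp (FinGSet.restrictHom H g) (FinGSet.restrictHom H f)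
  nm_comp g f := R.nm_comp (FinGSet.restrictHom H g) (FinGSet.restrictHom H f)
  subsingleton_of_isEmpty X hX := R.subsingleton_of_isEmpty (X.restrict H) hX
  bijective_of_coproduct i j hij :=
    R.bijective_of_coproduct (FinGSet.restrictHom H i) (FinGSet.restrictHom H j) hij
  res_tr a b f g h := R.res_tr (FinGSet.restrictHom H a) (FinGSet.restrictHom H b)
    (FinGSet.restrictHom H f) (FinGSet.restrictHom H g) h
  res_nm a b f g h := R.res_nm (FinGSet.restrictHom H a) (FinGSet.restrictHom H b)
    (FinGSet.restrictHom H f) (FinGSet.restrictHom H g) h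
  nm_tr p f e f' q h := R.nm_tr (FinGSet.restrictHom H p) (FinGSet.restrictHom H f)
    (FinGSet.restrictHom H e) (FinGSet.restrictHom H f') (FinGSet.restrictHom H q) h

/-- Norms along maps with nonempty fibres send zero to zero. -/
theorem nm_zero {G : Type u} [Group G] (R : TambaraFunctor.{u, w} G) {X Y : FinGSet G}
    (f : X →[G] Y) (hf : Function.Surjective f) : R.nm f 0 = 0 := by
  let E : FinGSet G := FinGSet.empty G
  let p : E →[G] X := ⟨fun x => x.elim, fun _ x => x.elim⟩
  let q : E →[G] Y := ⟨fun x => x.elim, fun _ x => x.elim⟩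
  have hE : IsEmpty E := inferInstanceAs (IsEmpty PEmpty)
  have hs : Subsingleton (R.obj E) := R.subsingleton_of_isEmpty E hE
  have key := R.nm_tr p f (MulActionHom.id G) (MulActionHom.id G) q
    ⟨⟨fun t => hE.elim t, fun _ t => hE.elim t⟩, fun y s => by
      obtain ⟨x, hx⟩ := hf y
      exact hE.elim (s ⟨x, hx⟩)⟩ 0
  rw [map_zero] at key
  rw [key, Subsingleton.elim (R.nm (MulActionHom.id G) _) (0 : R.obj E), map_zero]

end TambaraFunctor

/-! ### Ideals of Tambara functors -/

/-- A Tambara ideal of `R`: ideals of the rings `R (G ⧸ K)`, for the subgroups `K` of `G`, closed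
under transfers, norms and restrictions along all maps `G ⧸ K → G ⧸ L` of transitive `G`-sets.
(Every such map is the composite of a conjugation isomorphism `x K ↦ x g (g⁻¹ K g)` and a
projection `G ⧸ K' → G ⧸ L` with `K' ≤ L`.) -/
@[ext]
structure TambaraIdeal {G : Type u} [Group G] [Finite G] (R : TambaraFunctor.{u, w} G) where
  carrier : ∀ K : Subgroup G, Ideal (R.obj (FinGSet.orbit K))
  tr_mem : ∀ {K L : Subgroup G} (f : FinGSet.orbit K →[G] FinGSet.orbit L),
    ∀ a ∈ carrier K, R.tr f a ∈ carrier L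
  nm_mem : ∀ {K L : Subgroup G} (f : FinGSet.orbit K →[G] FinGSet.orbit L),
    ∀ a ∈ carrier K, R.nm f a ∈ carrier L
  res_mem : ∀ {K L : Subgroup G} (f : FinGSet.orbit K →[G] FinGSet.orbit L),
    ∀ a ∈ carrier L, R.res f a ∈ carrier K

theorem FinGSet.surjective_orbitHom {G : Type u} [Group G] [Finite G] {K L : Subgroup G}
    (f : FinGSet.orbit K →[G] FinGSet.orbit L) : Function.Surjective f := by
  intro y
  let x : FinGSet.orbit K := (QuotientGroup.mk 1 : G ⧸ K)
  obtain ⟨g, hg⟩ := MulAction.exists_smul_eq G (show G ⧸ L from f x) (show G ⧸ L from y)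
  exact ⟨g • x, (f.map_smul g x).trans hg⟩

namespace TambaraIdeal

variable {G : Type u} [Group G] [Finite G] {R : TambaraFunctor.{u, w} G}

/-- Containment of Tambara ideals. -/
instance : LE (TambaraIdeal R) := ⟨fun I J => ∀ K, I.carrier K ≤ J.carrier K⟩

/-- The zero Tambara ideal. -/
instance : Bot (TambaraIdeal R) where
  bot :=
    { carrier := fun _ => ⊥
      tr_mem := fun f a ha => by
        rw [Ideal.mem_bot] at ha ⊢
        rw [ha, map_zero]
      nm_mem := fun f a ha => by
        rw [Ideal.mem_bot] at ha ⊢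
        rw [ha, R.nm_zero f (FinGSet.surjective_orbitHom f)]
      res_mem := fun f a ha => by
        rw [Ideal.mem_bot] at ha ⊢
        rw [ha, map_zero] }

/-- The Tambara ideal that is everything. -/
instance : Top (TambaraIdeal R) where
  top :=
    { carrier := fun _ => ⊤
      tr_mem := fun _ _ _ => Submodule.mem_top
      nm_mem := fun _ _ _ => Submodule.mem_top
      res_mem := fun _ _ _ => Submodule.mem_top }

/-- The Tambara ideal generated by a family of sets `S K ⊆ R (G ⧸ K)`: the intersection of all
Tambara ideals that contain it. -/
def span (S : ∀ K : Subgroup G, Set (R.obj (FinGSet.orbit K))) : TambaraIdeal R where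
  carrier K := ⨅ Q : {Q : TambaraIdeal R // ∀ L, S L ⊆ Q.carrier L}, Q.1.carrier K
  tr_mem f a ha := by
    rw [Ideal.mem_iInf] at ha ⊢
    exact fun Q => Q.1.tr_mem f a (ha Q)
  nm_mem f a ha := by
    rw [Ideal.mem_iInf] at ha ⊢
    exact fun Q => Q.1.nm_mem f a (ha Q)
  res_mem f a ha := by
    rw [Ideal.mem_iInf] at ha ⊢
    exact fun Q => Q.1.res_mem f a (ha Q)

/-- The product of two Tambara ideals: the Tambara ideal generated by the products of elements of
the same level. -/
instance : Mul (TambaraIdeal R) where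
  mul I J := span fun K => {c | ∃ a ∈ I.carrier K, ∃ b ∈ J.carrier K, c = a * b}

/-- A Tambara ideal `P` is prime if it is proper and `I * J ≤ P` implies `I ≤ P` or `J ≤ P`, for all
Tambara ideals `I` and `J`. -/
structure IsPrime (P : TambaraIdeal R) : Prop where
  ne_top : P ≠ ⊤
  le_or_le : ∀ I J : TambaraIdeal R, I * J ≤ P → I ≤ P ∨ J ≤ P

end TambaraIdeal

/-- A Tambara functor is domain-like if its zero ideal is prime. -/
def TambaraFunctor.IsDomainLike {G : Type u} [Group G] [Finite G]
    (R : TambaraFunctor.{u, w} G) : Prop :=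
  (⊥ : TambaraIdeal R).IsPrime

/-! The correspondence between Tambara ideals of `R` and of `CoInd R` rests on two facts. A finite
`G`-set is a disjoint union of orbits, so a Tambara ideal extends to all finite `G`-sets, and
evaluating this extension at the underlying `H`-sets of the orbits `G ⧸ K` gives an ideal of
`CoInd R`. In the other direction, `H ⧸ L` is a union of components of the underlying `H`-set of
`G ⧸ L`, so `R (H ⧸ L)` is a direct factor of `(CoInd R) (G ⧸ L)`, and cutting an ideal of `CoInd R`
down to these factors inverts the construction. Since products are detected levelwise, prime ideals
correspond to prime ideals.

For rings, elements `a` and `b` of `R` extend by zero from `H` to `G`. The product of the extension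
of `a` with the translate by `g` of that of `b` is the extension of `a * (g • b)` if `g ∈ H`, and
zero otherwise, so a `G`-prime ideal of the coinduction restricts to an `H`-prime one. Conversely,
two functions nonzero modulo an ideal at `x` and `y` can be brought together at `x` by translation,
since left equivariance realises every `h • ψ y` as a value of `ψ`. -/

/-! ### Prime ideals of coinduced rings -/

namespace coindRing

variable {G : Type u} [Group G] (H : Subgroup G) {R : Type v} [CommRing R] [MulSemiringAction H R]

/-- The coinduction of an ideal: the equivariant functions with values in it. -/
def coindIdeal (I : Ideal R) : Ideal (coindRing H R) where
  carrier := {φ | ∀ x, φ.1 x ∈ I}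
  zero_mem' _ := I.zero_mem
  add_mem' hφ hψ x := I.add_mem (hφ x) (hψ x)
  smul_mem' φ _ hψ x := I.mul_mem_left (φ.1 x) (hψ x)

variable {H}

theorem mem_coindIdeal {I : Ideal R} {φ : coindRing H R} :
    φ ∈ coindIdeal H I ↔ ∀ x, φ.1 x ∈ I := Iff.rfl

theorem coindIdeal_bot : coindIdeal H (⊥ : Ideal R) = ⊥ := by
  ext φ
  exact funext_iff.symm.trans (Subtype.ext_iff (a2 := (0 : coindRing H R))).symm

theorem coindIdeal_eq_top_iff {I : Ideal R} : coindIdeal H I = ⊤ ↔ I = ⊤ := by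
  rw [Ideal.eq_top_iff_one, Ideal.eq_top_iff_one, mem_coindIdeal]
  exact forall_const (α := G) (b := (1 : R) ∈ I)

variable (H) in
/-- The extension by zero of the equivariant function `h ↦ h • a` from `H` to `G`. -/
noncomputable def single (a : R) : coindRing H R where
  val := Function.extend ((↑) : H → G) (fun h => h • a) 0
  property h x := by
    by_cases hx : x ∈ H
    · lift x to H using hx
      rw [← Subgroup.coe_mul, Subtype.val_injective.extend_apply,
        Subtype.val_injective.extend_apply, mul_smul]
    · rw [Function.extend_apply', Function.extend_apply', Pi.zero_apply, Pi.zero_apply, smul_zero]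
      · simpa using hx
      · simpa [H.mul_mem_cancel_left h.2] using hx

theorem single_coe (a : R) (h : H) : (single H a).1 h = h • a :=
  Subtype.val_injective.extend_apply (fun h : H => h • a) 0 h

theorem single_of_notMem (a : R) {x : G} (hx : x ∉ H) : (single H a).1 x = 0 :=
  Function.extend_apply' (fun h : H => h • a) (0 : G → R) x fun ⟨h, hh⟩ => hx (hh ▸ h.2)

theorem single_mem_coindIdeal_iff {I : Ideal R} (hI : ∀ h : H, ∀ x ∈ I, h • x ∈ I) {a : R} :
    single H a ∈ coindIdeal H I ↔ a ∈ I := by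
  constructor
  · intro h
    simpa only [single_coe, one_smul] using h (1 : H)
  · intro ha x
    by_cases hx : x ∈ H
    · lift x to H using hx
      rw [single_coe]
      exact hI x a ha
    · rw [single_of_notMem a hx]
      exact I.zero_mem

theorem single_mul_smul_single (a b : R) (h : H) :
    single H a * (h : G) • single H b = single H (a * h • b) := by
  refine Subtype.ext (funext fun x => ?_)
  change (single H a).1 x * (single H b).1 (x * h) = (single H (a * h • b)).1 x
  by_cases hx : x ∈ H
  · lift x to H using hx
    rw [← Subgroup.coe_mul, single_coe, single_coe, single_coe, smul_mul', mul_smul]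
  · rw [single_of_notMem a hx, single_of_notMem _ hx, zero_mul]

theorem single_mul_smul_single_of_notMem (a b : R) {g : G} (hg : g ∉ H) :
    single H a * g • single H b = 0 := by
  refine Subtype.ext (funext fun x => ?_)
  change (single H a).1 x * (single H b).1 (x * g) = 0
  by_cases hx : x ∈ H
  · rw [single_of_notMem b (by rwa [H.mul_mem_cancel_left hx]), mul_zero]
  · rw [single_of_notMem a hx, zero_mul]

theorem isGPrime_coindIdeal {I : Ideal R} (h : IsGPrime H I) : IsGPrime G (coindIdeal H I) where
  smul_mem g _ hφ x := hφ (x * g)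
  ne_top := mt coindIdeal_eq_top_iff.1 h.ne_top
  exists_mul_smul_notMem φ ψ hφ hψ := by
    simp only [mem_coindIdeal, not_forall] at hφ hψ
    obtain ⟨x, hx⟩ := hφ
    obtain ⟨y, hy⟩ := hψ
    obtain ⟨k, hk⟩ := h.exists_mul_smul_notMem _ _ hx hy
    refine ⟨x⁻¹ * (k * y), fun hmem => hk ?_⟩
    have hx_mem : φ.1 x * ψ.1 (x * (x⁻¹ * (k * y))) ∈ I := hmem x
    rwa [mul_inv_cancel_left, ψ.2] at hx_mem

theorem isGPrime_of_coindIdeal {I : Ideal R} (hI : ∀ h : H, ∀ x ∈ I, h • x ∈ I)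
    (h : IsGPrime G (coindIdeal H I)) : IsGPrime H I where
  smul_mem := hI
  ne_top := mt coindIdeal_eq_top_iff.2 h.ne_top
  exists_mul_smul_notMem a b ha hb := by
    obtain ⟨g, hg⟩ := h.exists_mul_smul_notMem (single H a) (single H b)
      (mt (single_mem_coindIdeal_iff hI).1 ha) (mt (single_mem_coindIdeal_iff hI).1 hb)
    have hgH : g ∈ H := by
      by_contra hgH
      rw [single_mul_smul_single_of_notMem a b hgH] at hg
      exact hg (zero_mem _)
    lift g to H using hgH
    rw [single_mul_smul_single, single_mem_coindIdeal_iff hI] at hg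
    exact ⟨g, hg⟩

end coindRing

/-! ### Constructions of finite `G`-sets -/

theorem IsPullbackSquare.of_injective {W X Y Z : Type u} {a : W → X} {b : W → Y} {f : X → Z}
    {g : Y → Z} (ha : Function.Injective a) (hg : Function.Injective g)
    (hcomm : ∀ t, f (a t) = g (b t)) (hrange : ∀ x y, f x = g y → x ∈ Set.range a) :
    IsPullbackSquare a b f g := by
  refine ⟨hcomm, fun x y hxy => ?_⟩
  obtain ⟨t, rfl⟩ := hrange x y hxy
  exact ⟨t, ⟨rfl, hg ((hcomm t).symm.trans hxy)⟩, fun _ ht => ha ht.1⟩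

namespace FinGSet

variable {G : Type u} [Group G]

instance : IsEmpty (empty G) := inferInstanceAs (IsEmpty PEmpty)

/-- The map from the empty `G`-set. -/
def emptyHom (X : FinGSet G) : empty G →[G] X :=
  ⟨fun x => x.elim, fun _ x => x.elim⟩

theorem isPullbackSquare_emptyHom_of_disjoint {X Y Z : FinGSet G} {f : X →[G] Z} {g : Y →[G] Z}
    (h : ∀ x y, f x ≠ g y) : IsPullbackSquare (emptyHom X) (emptyHom Y) f g :=
  ⟨fun t => isEmptyElim t, fun x y hxy => (h x y hxy).elim⟩

theorem isPullbackSquare_id_of_injective {X Y : FinGSet G} {f : X →[G] Y}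
    (hf : Function.Injective f) :
    IsPullbackSquare (MulActionHom.id G (X := X)) (MulActionHom.id G (X := X)) f f :=
  .of_injective Function.injective_id hf (fun _ => rfl) fun x _ _ => ⟨x, rfl⟩

/-- An invariant subset of a finite `G`-set, as a finite `G`-set. -/
def ofSubMulAction {X : FinGSet G} (S : SubMulAction G X) : FinGSet G where
  carrier := S

/-- The complement of the image of a map of finite `G`-sets. -/
def compl {X Y : FinGSet G} (f : X →[G] Y) : FinGSet G :=
  ofSubMulAction (X := Y)
    { carrier := (Set.range f)ᶜ
      smul_mem' := fun g y hy ⟨x, hx⟩ => hy ⟨g⁻¹ • x, by rw [map_smul, hx, inv_smul_smul]⟩ }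

/-- The inclusion of the complement of the image of a map of finite `G`-sets. -/
def complHom {X Y : FinGSet G} (f : X →[G] Y) : compl f →[G] Y :=
  SubMulAction.subtype _

theorem bijective_sumElim_complHom {X Y : FinGSet G} {f : X →[G] Y}
    (hf : Function.Injective f) : Function.Bijective (Sum.elim f (complHom f)) := by
  refine ⟨hf.sumElim Subtype.val_injective fun x y h => y.2 ⟨x, h⟩, fun y => ?_⟩
  by_cases hy : y ∈ Set.range f
  · obtain ⟨x, hx⟩ := hy
    exact ⟨Sum.inl x, hx⟩
  · exact ⟨Sum.inr ⟨y, hy⟩, rfl⟩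

theorem card_compl_lt {X Y : FinGSet G} (f : X →[G] Y) [Nonempty X] :
    Nat.card (compl f) < Nat.card Y :=
  Finite.card_subtype_lt (x := f (Classical.arbitrary X)) fun h => h ⟨_, rfl⟩

/-- The fibre product of finite `G`-sets. -/
def fiberProduct {X Y Z : FinGSet G} (f : X →[G] Z) (g : Y →[G] Z) : FinGSet G :=
  ofSubMulAction (X := ⟨X × Y⟩)
    { carrier := {p | f p.1 = g p.2}
      smul_mem' := fun k p hp => by
        change f (k • p.1) = g (k • p.2)
        rw [map_smul, map_smul, hp] }

/-- The first projection of a fibre product. -/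
def fiberProductFst {X Y Z : FinGSet G} (f : X →[G] Z) (g : Y →[G] Z) :
    fiberProduct f g →[G] X := ⟨fun p => p.1.1, fun _ _ => rfl⟩

/-- The second projection of a fibre product. -/
def fiberProductSnd {X Y Z : FinGSet G} (f : X →[G] Z) (g : Y →[G] Z) :
    fiberProduct f g →[G] Y := ⟨fun p => p.1.2, fun _ _ => rfl⟩

theorem isPullbackSquare_fiberProduct {X Y Z : FinGSet G} (f : X →[G] Z) (g : Y →[G] Z) :
    IsPullbackSquare (fiberProductFst f g) (fiberProductSnd f g) f g :=
  ⟨fun t => t.2, fun x y h => ⟨⟨(x, y), h⟩, ⟨rfl, rfl⟩,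
    fun _ ht => Subtype.ext (Prod.ext ht.1 ht.2)⟩⟩

section Orbit

variable [Finite G]

/-- The coset `g K` as a point of the `G`-set `G ⧸ K`. -/
def orbitMk (K : Subgroup G) (g : G) : orbit K := (QuotientGroup.mk g : G ⧸ K)

theorem orbitMk_surjective (K : Subgroup G) : Function.Surjective (orbitMk K) :=
  QuotientGroup.mk_surjective

instance (K : Subgroup G) : Nonempty (orbit K) := ⟨orbitMk K 1⟩

theorem smul_orbitMk (K : Subgroup G) (g k : G) : g • orbitMk K k = orbitMk K (g * k) := rfl

theorem orbitMk_eq_iff {K : Subgroup G} {g k : G} :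
    orbitMk K g = orbitMk K k ↔ g⁻¹ * k ∈ K :=
  QuotientGroup.eq

theorem hom_orbitMk {K : Subgroup G} {X : FinGSet G} (t : orbit K →[G] X) (g : G) :
    t (orbitMk K g) = g • t (orbitMk K 1) := by
  rw [← map_smul, smul_orbitMk, mul_one]

theorem orbitHom_ext {K : Subgroup G} {X : FinGSet G} {s t : orbit K →[G] X}
    (h : s (orbitMk K 1) = t (orbitMk K 1)) : s = t := by
  ext x
  obtain ⟨g, rfl⟩ := orbitMk_surjective K x
  rw [hom_orbitMk s, hom_orbitMk t, h]

theorem le_stabilizer_hom_orbitMk_one {K : Subgroup G} {X : FinGSet G} (t : orbit K →[G] X) :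
    K ≤ MulAction.stabilizer G (t (orbitMk K 1)) := fun g hg => by
  have hg_one : g⁻¹ * 1 ∈ K := by simpa using hg
  rw [MulAction.mem_stabilizer_iff, ← hom_orbitMk, orbitMk_eq_iff.2 hg_one]

/-- The map `G ⧸ K → X` given by `g K ↦ g • x`, for a point `x` fixed by `K`. -/
def orbitLift {K : Subgroup G} {X : FinGSet G} (x : X) (hx : K ≤ MulAction.stabilizer G x) :
    orbit K →[G] X where
  toFun y := MulAction.ofQuotientStabilizer G x (Subgroup.quotientMapOfLE hx y)
  map_smul' g y := by
    obtain ⟨k, rfl⟩ := orbitMk_surjective K y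
    exact mul_smul g k x

theorem exists_injective_orbitHom {X : FinGSet G} (x : X) :
    ∃ (K : Subgroup G) (t : orbit K →[G] X), Function.Injective t := by
  refine ⟨_, orbitLift x le_rfl, fun y z h => ?_⟩
  obtain ⟨g, rfl⟩ := orbitMk_surjective _ y
  obtain ⟨k, rfl⟩ := orbitMk_surjective _ z
  exact MulAction.injective_ofQuotientStabilizer G x h

end Orbit

/-! ### Induction of orbits from a subgroup -/

section Induction

variable [Finite G] {H : Subgroup G}

/-- The inclusion of `H ⧸ L` into the underlying `H`-set of `G ⧸ L`; it is the unit at `H ⧸ L` of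
the adjunction between induction and restriction of finite `G`-sets. -/
def unitHom (L : Subgroup H) : orbit L →[H] (orbit (L.map H.subtype)).restrict H :=
  orbitLift (X := (orbit (L.map H.subtype)).restrict H) (orbitMk (L.map H.subtype) 1) fun _ hl =>
    le_stabilizer_hom_orbitMk_one (MulActionHom.id G) (Subgroup.mem_map_of_mem H.subtype hl)

theorem unitHom_orbitMk (L : Subgroup H) (h : H) :
    unitHom L (orbitMk L h) = orbitMk (L.map H.subtype) h :=
  congrArg (orbitMk (L.map H.subtype)) (mul_one (h : G))

theorem unitHom_injective (L : Subgroup H) : Function.Injective (unitHom L) := by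
  intro y z hyz
  obtain ⟨h, rfl⟩ := orbitMk_surjective L y
  obtain ⟨k, rfl⟩ := orbitMk_surjective L z
  rw [unitHom_orbitMk, unitHom_orbitMk] at hyz
  rw [orbitMk_eq_iff]
  exact (Subgroup.mem_map_iff_mem H.subtype_injective).1 (orbitMk_eq_iff.1 hyz)

theorem orbitMk_mem_range_unitHom_iff {L : Subgroup H} {g : G} :
    orbitMk (L.map H.subtype) g ∈ Set.range (unitHom L) ↔ g ∈ H := by
  constructor
  · rintro ⟨y, hy⟩
    obtain ⟨h, rfl⟩ := orbitMk_surjective L y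
    rw [unitHom_orbitMk] at hy
    exact (H.mul_mem_cancel_left (H.inv_mem h.2)).1
      (Subgroup.map_subtype_le L (orbitMk_eq_iff.1 hy))
  · exact fun hg => ⟨orbitMk L ⟨g, hg⟩, unitHom_orbitMk L ⟨g, hg⟩⟩

/-- The map `G ⧸ L → X` adjoint to a map from `H ⧸ L` to the underlying `H`-set of `X`. -/
def adjointHom {L : Subgroup H} {X : FinGSet G} (t : orbit L →[H] X.restrict H) :
    orbit (L.map H.subtype) →[G] X :=
  orbitLift (X := X) (t (orbitMk L 1))
    (Subgroup.map_le_iff_le_comap.2 (le_stabilizer_hom_orbitMk_one t))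

theorem adjointHom_comp_unitHom {L : Subgroup H} {X : FinGSet G}
    (t : orbit L →[H] X.restrict H) :
    (restrictHom H (adjointHom t)).comp (unitHom L) = t := by
  refine orbitHom_ext ?_
  change adjointHom t (unitHom L (orbitMk L 1)) = _
  rw [unitHom_orbitMk]
  exact one_smul G _

/-- The map `G ⧸ K → G ⧸ L` induced from a map `H ⧸ K → H ⧸ L`. -/
def inducedHom {K L : Subgroup H} (f : orbit K →[H] orbit L) :
    orbit (K.map H.subtype) →[G] orbit (L.map H.subtype) :=
  adjointHom ((unitHom L).comp f)

theorem inducedHom_comp_unitHom {K L : Subgroup H} (f : orbit K →[H] orbit L) :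
    (restrictHom H (inducedHom f)).comp (unitHom K) = (unitHom L).comp f :=
  adjointHom_comp_unitHom _

theorem inducedHom_mem_range_unitHom_iff {K L : Subgroup H} (f : orbit K →[H] orbit L)
    {x : orbit (K.map H.subtype)} :
    inducedHom f x ∈ Set.range (unitHom L) ↔ x ∈ Set.range (unitHom K) := by
  obtain ⟨g, rfl⟩ := orbitMk_surjective _ x
  obtain ⟨h, hh⟩ := orbitMk_surjective L (f (orbitMk K 1))
  have hg : inducedHom f (orbitMk _ g) = orbitMk (L.map H.subtype) (g * h) := by
    change g • (show orbit (L.map H.subtype) from unitHom L (f (orbitMk K 1))) = _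
    rw [← hh, unitHom_orbitMk]
    rfl
  rw [hg, orbitMk_mem_range_unitHom_iff, orbitMk_mem_range_unitHom_iff,
    H.mul_mem_cancel_right h.2]

theorem isPullbackSquare_inducedHom {K L : Subgroup H} (f : orbit K →[H] orbit L) :
    IsPullbackSquare (unitHom K) f (restrictHom H (inducedHom f)) (unitHom L) :=
  .of_injective (unitHom_injective K) (unitHom_injective L)
    (DFunLike.congr_fun (inducedHom_comp_unitHom f))
    fun _ y hxy => (inducedHom_mem_range_unitHom_iff f).1 ⟨y, hxy.symm⟩

end Induction

end FinGSet

/-! ### Transfers and norms along disjoint unions -/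

namespace TambaraFunctor

open FinGSet

variable {G : Type u} [Group G] (R : TambaraFunctor.{u, w} G)

theorem res_tr_of_injective {X Y : FinGSet G} {f : X →[G] Y} (hf : Function.Injective f)
    (a : R.obj X) : R.res f (R.tr f a) = a := by
  rw [R.res_tr _ _ f f (isPullbackSquare_id_of_injective hf), R.res_id, R.tr_id]

theorem res_nm_of_injective {X Y : FinGSet G} {f : X →[G] Y} (hf : Function.Injective f)
    (a : R.obj X) : R.res f (R.nm f a) = a := by
  rw [R.res_nm _ _ f f (isPullbackSquare_id_of_injective hf), R.res_id, R.nm_id]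

theorem res_tr_of_disjoint {X Y Z : FinGSet G} {f : X →[G] Z} {g : Y →[G] Z}
    (h : ∀ x y, f x ≠ g y) (a : R.obj X) : R.res g (R.tr f a) = 0 := by
  have := R.subsingleton_of_isEmpty (empty G) inferInstance
  rw [R.res_tr _ _ f g (isPullbackSquare_emptyHom_of_disjoint h),
    Subsingleton.elim (R.res _ a) 0, map_zero]

theorem res_nm_of_disjoint {X Y Z : FinGSet G} {f : X →[G] Z} {g : Y →[G] Z}
    (h : ∀ x y, f x ≠ g y) (a : R.obj X) : R.res g (R.nm f a) = 1 := by
  have := R.subsingleton_of_isEmpty (empty G) inferInstance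
  rw [R.res_nm _ _ f g (isPullbackSquare_emptyHom_of_disjoint h),
    Subsingleton.elim (R.res _ a) 1, map_one]

section Coproduct

variable {X Y Z : FinGSet G} {i : X →[G] Z} {j : Y →[G] Z}

theorem eq_of_res_eq_of_coproduct (h : Function.Bijective (Sum.elim i j)) {c d : R.obj Z}
    (hi : R.res i c = R.res i d) (hj : R.res j c = R.res j d) : c = d :=
  (R.bijective_of_coproduct i j h).1 (Prod.ext hi hj)

theorem tr_res_add_tr_res (h : Function.Bijective (Sum.elim i j)) (c : R.obj Z) :
    R.tr i (R.res i c) + R.tr j (R.res j c) = c := by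
  obtain ⟨hi, hj, hij⟩ := Sum.elim_injective.1 h.1
  refine R.eq_of_res_eq_of_coproduct h ?_ ?_
  · rw [map_add, R.res_tr_of_injective hi, R.res_tr_of_disjoint fun y x => (hij x y).symm, add_zero]
  · rw [map_add, R.res_tr_of_injective hj, R.res_tr_of_disjoint hij, zero_add]

theorem nm_res_mul_nm_res (h : Function.Bijective (Sum.elim i j)) (c : R.obj Z) :
    R.nm i (R.res i c) * R.nm j (R.res j c) = c := by
  obtain ⟨hi, hj, hij⟩ := Sum.elim_injective.1 h.1
  refine R.eq_of_res_eq_of_coproduct h ?_ ?_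
  · rw [map_mul, R.res_nm_of_injective hi, R.res_nm_of_disjoint fun y x => (hij x y).symm, mul_one]
  · rw [map_mul, R.res_nm_of_injective hj, R.res_nm_of_disjoint hij, one_mul]

end Coproduct

theorem tr_mul_res_of_injective {X Y : FinGSet G} {f : X →[G] Y} (hf : Function.Injective f)
    (a : R.obj X) (c : R.obj Y) : R.tr f (a * R.res f c) = R.tr f a * c := by
  have hdisj : ∀ x y, f x ≠ complHom f y := fun x y h => y.2 ⟨x, h⟩
  refine R.eq_of_res_eq_of_coproduct (bijective_sumElim_complHom hf) ?_ ?_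
  · rw [R.res_tr_of_injective hf, map_mul, R.res_tr_of_injective hf]
  · rw [R.res_tr_of_disjoint hdisj, map_mul, R.res_tr_of_disjoint hdisj, zero_mul]

theorem tr_mul_of_injective {X Y : FinGSet G} {f : X →[G] Y} (hf : Function.Injective f)
    (a b : R.obj X) : R.tr f (a * b) = R.tr f a * R.tr f b := by
  rw [← R.tr_mul_res_of_injective hf, R.res_tr_of_injective hf]

theorem mem_map_res_iff_of_injective {X Y : FinGSet G} {f : X →[G] Y} (hf : Function.Injective f)
    {I : Ideal (R.obj Y)} {a : R.obj X} : a ∈ I.map (R.res f) ↔ R.tr f a ∈ I := by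
  have hsurj : Function.Surjective (R.res f) := fun a => ⟨R.tr f a, R.res_tr_of_injective hf a⟩
  constructor
  · intro ha
    obtain ⟨b, hb, rfl⟩ := (Ideal.mem_map_iff_of_surjective _ hsurj).1 ha
    have htr : R.tr f (R.res f b) = R.tr f 1 * b := by
      rw [← R.tr_mul_res_of_injective hf, one_mul]
    rw [htr]
    exact I.mul_mem_left _ hb
  · intro ha
    rw [← R.res_tr_of_injective hf a]
    exact Ideal.mem_map_of_mem _ ha

theorem mem_of_tr_res_mem [Finite G] {X : FinGSet G} (A : AddSubmonoid (R.obj X)) (c : R.obj X)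
    (h : ∀ (K : Subgroup G) (t : orbit K →[G] X), R.tr t (R.res t c) ∈ A) : c ∈ A := by
  induction hn : Nat.card X using Nat.strong_induction_on generalizing X with
  | _ n ih =>
    rcases isEmpty_or_nonempty X with hX | ⟨⟨x⟩⟩
    · have := R.subsingleton_of_isEmpty X hX
      rw [Subsingleton.elim c 0]
      exact A.zero_mem
    · obtain ⟨K, t, ht⟩ := exists_injective_orbitHom x
      rw [← R.tr_res_add_tr_res (bijective_sumElim_complHom ht) c]
      refine A.add_mem (h K t) (ih _ (hn ▸ card_compl_lt t) (A.comap (R.tr (complHom t))) _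
        (fun L s => ?_) rfl)
      rw [AddSubmonoid.mem_comap, ← R.res_comp, ← R.tr_comp]
      exact h L _

end TambaraFunctor

/-! ### Tambara ideals on all finite `G`-sets -/

namespace TambaraIdeal

open FinGSet

section Extend

variable {G : Type u} [Group G] [Finite G] {R : TambaraFunctor.{u, w} G} {I J P : TambaraIdeal R}

/-- The value of a Tambara ideal on an arbitrary finite `G`-set: the elements all of whose
restrictions to orbits lie in the ideal. -/
def extend (I : TambaraIdeal R) (X : FinGSet G) : Ideal (R.obj X) :=
  ⨅ (K : Subgroup G) (t : orbit K →[G] X), (I.carrier K).comap (R.res t)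

theorem mem_extend {X : FinGSet G} {a : R.obj X} :
    a ∈ I.extend X ↔ ∀ (K : Subgroup G) (t : orbit K →[G] X), R.res t a ∈ I.carrier K := by
  simp only [extend, Ideal.mem_iInf, Ideal.mem_comap]

theorem extend_orbit (K : Subgroup G) : I.extend (orbit K) = I.carrier K := by
  ext a
  rw [mem_extend]
  refine ⟨fun h => ?_, fun h L t => I.res_mem t a h⟩
  rw [← R.res_id _ a]
  exact h K (MulActionHom.id G)

theorem extend_mono (h : I ≤ J) (X : FinGSet G) : I.extend X ≤ J.extend X :=
  fun _ ha => mem_extend.2 fun K t => h K (mem_extend.1 ha K t)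

theorem res_mem_extend {X Y : FinGSet G} (f : X →[G] Y) {a : R.obj Y} (ha : a ∈ I.extend Y) :
    R.res f a ∈ I.extend X := by
  refine mem_extend.2 fun K t => ?_
  rw [← R.res_comp]
  exact mem_extend.1 ha K _

theorem tr_mem_extend {X Y : FinGSet G} (f : X →[G] Y) {a : R.obj X} (ha : a ∈ I.extend X) :
    R.tr f a ∈ I.extend Y := by
  refine mem_extend.2 fun K t => ?_
  rw [R.res_tr _ _ f t (isPullbackSquare_fiberProduct f t)]
  refine R.mem_of_tr_res_mem
    ((I.carrier K).toAddSubmonoid.comap (R.tr (fiberProductSnd f t))) _ fun L s => ?_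
  change R.tr (fiberProductSnd f t) _ ∈ I.carrier K
  rw [← R.tr_comp]
  exact I.tr_mem _ _ (mem_extend.1 (res_mem_extend _ ha) L s)

theorem nm_mem_extend {X Y : FinGSet G} {f : X →[G] Y} (hf : Function.Surjective f)
    {a : R.obj X} (ha : a ∈ I.extend X) : R.nm f a ∈ I.extend Y := by
  refine mem_extend.2 fun K t => ?_
  rw [R.res_nm _ _ f t (isPullbackSquare_fiberProduct f t)]
  -- As `f` is surjective, the fibre product contains an orbit. The norm along this orbit is a
  -- factor of the whole norm and lies in the ideal; over an empty fibre the norm would be `1`.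
  obtain ⟨x, hx⟩ := hf (t (orbitMk K 1))
  obtain ⟨L, s, hs⟩ := exists_injective_orbitHom (X := fiberProduct f t) ⟨(x, orbitMk K 1), hx⟩
  rw [← R.nm_res_mul_nm_res (bijective_sumElim_complHom hs) (R.res (fiberProductFst f t) a),
    map_mul, ← R.nm_comp]
  exact Ideal.mul_mem_right _ _ (I.nm_mem _ _ (mem_extend.1 (res_mem_extend _ ha) L s))

theorem tr_mem_extend_iff {X Y : FinGSet G} {f : X →[G] Y} (hf : Function.Injective f)
    {a : R.obj X} : R.tr f a ∈ I.extend Y ↔ a ∈ I.extend X := by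
  refine ⟨fun h => ?_, tr_mem_extend f⟩
  rw [← R.res_tr_of_injective hf a]
  exact res_mem_extend f h

theorem mul_le_iff : I * J ≤ P ↔
    ∀ K, ∀ a ∈ I.carrier K, ∀ b ∈ J.carrier K, a * b ∈ P.carrier K := by
  constructor
  · intro h K a ha b hb
    exact h K (Ideal.mem_iInf.2 fun Q => Q.2 K ⟨a, ha, b, hb, rfl⟩)
  · intro h K c hc
    refine Ideal.mem_iInf.1 hc ⟨P, ?_⟩
    rintro L _ ⟨a, ha, b, hb, rfl⟩
    exact h L a ha b hb

end Extend

/-! ### Tambara ideals of the coinduction -/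

section Coind

variable {G : Type u} [Group G] [Finite G] {H : Subgroup G} {R : TambaraFunctor.{u, w} H}

/-- The coinduction of a Tambara ideal: its value at `G ⧸ K` is the value of the ideal at the
underlying `H`-set of `G ⧸ K`. -/
def coind (I : TambaraIdeal R) : TambaraIdeal (TambaraFunctor.coind H R) where
  carrier K := I.extend ((orbit K).restrict H)
  tr_mem f _ ha := tr_mem_extend (restrictHom H f) ha
  nm_mem f _ ha := nm_mem_extend (f := restrictHom H f) (surjective_orbitHom f) ha
  res_mem f _ ha := res_mem_extend (restrictHom H f) ha

theorem mem_coind {I : TambaraIdeal R} {K : Subgroup G}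
    {a : R.obj ((orbit K).restrict H)} : a ∈ I.coind.carrier K ↔
      ∀ (L : Subgroup H) (t : orbit L →[H] (orbit K).restrict H), R.res t a ∈ I.carrier L :=
  mem_extend

theorem tr_unitHom_mem_coind_iff {I : TambaraIdeal R} {L : Subgroup H} {a : R.obj (orbit L)} :
    R.tr (unitHom L) a ∈ I.coind.carrier (L.map H.subtype) ↔ a ∈ I.carrier L :=
  (tr_mem_extend_iff (unitHom_injective L)).trans (by rw [extend_orbit])

/-- The Tambara ideal of `R` cut out by a Tambara ideal `J` of the coinduction of `R`: its value at
`H ⧸ L` is the image of `J (G ⧸ L)` under restriction to the direct factor `R (H ⧸ L)` of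
`(CoInd R) (G ⧸ L)`. -/
def ofCoind (J : TambaraIdeal (TambaraFunctor.coind H R)) : TambaraIdeal R where
  carrier L := Ideal.map (R.res (unitHom L)) (J.carrier (L.map H.subtype))
  tr_mem {K L} f a ha := by
    have ha' := J.tr_mem (inducedHom f) _
      ((R.mem_map_res_iff_of_injective (unitHom_injective K)).1 ha)
    rw [← R.res_tr_of_injective (unitHom_injective K) a,
      ← R.res_tr _ _ _ _ (isPullbackSquare_inducedHom f)]
    exact Ideal.mem_map_of_mem _ ha'
  nm_mem {K L} f a ha := by
    have ha' := J.nm_mem (inducedHom f) _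
      ((R.mem_map_res_iff_of_injective (unitHom_injective K)).1 ha)
    rw [← R.res_tr_of_injective (unitHom_injective K) a,
      ← R.res_nm _ _ _ _ (isPullbackSquare_inducedHom f)]
    exact Ideal.mem_map_of_mem _ ha'
  res_mem {K L} f a ha := by
    have ha' := J.res_mem (inducedHom f) _
      ((R.mem_map_res_iff_of_injective (unitHom_injective L)).1 ha)
    rw [← R.res_tr_of_injective (unitHom_injective L) a, ← R.res_comp,
      ← inducedHom_comp_unitHom, R.res_comp]
    exact Ideal.mem_map_of_mem _ ha'

theorem mem_ofCoind {J : TambaraIdeal (TambaraFunctor.coind H R)} {L : Subgroup H}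
    {a : R.obj (orbit L)} :
    a ∈ J.ofCoind.carrier L ↔ R.tr (unitHom L) a ∈ J.carrier (L.map H.subtype) :=
  R.mem_map_res_iff_of_injective (unitHom_injective L)

theorem ofCoind_coind (I : TambaraIdeal R) : I.coind.ofCoind = I := by
  ext L a
  rw [mem_ofCoind, tr_unitHom_mem_coind_iff]

theorem coind_ofCoind (J : TambaraIdeal (TambaraFunctor.coind H R)) : J.ofCoind.coind = J := by
  refine TambaraIdeal.ext (funext fun K => Ideal.ext fun (a : R.obj ((orbit K).restrict H)) => ?_)
  refine mem_coind.trans ⟨fun h => ?_, fun ha L t => ?_⟩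
  · refine R.mem_of_tr_res_mem (X := (orbit K).restrict H) (J.carrier K).toAddSubmonoid a
      fun L t => ?_
    have ht := J.tr_mem (adjointHom t) _ (mem_ofCoind.1 (h L t))
    change R.tr (restrictHom H (adjointHom t)) _ ∈ J.carrier K at ht
    rwa [← R.tr_comp, adjointHom_comp_unitHom] at ht
  · rw [← adjointHom_comp_unitHom t, R.res_comp]
    exact Ideal.mem_map_of_mem (R.res (unitHom L)) (J.res_mem (adjointHom t) a ha)

/-- Coinduction identifies the Tambara ideals of `R` with those of the coinduction of `R`. -/
def coindOrderIso : TambaraIdeal R ≃o TambaraIdeal (TambaraFunctor.coind H R) where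
  toFun := coind
  invFun := ofCoind
  left_inv := ofCoind_coind
  right_inv := coind_ofCoind
  map_rel_iff' := ⟨fun h _ _ ha =>
    tr_unitHom_mem_coind_iff.1 (h _ (tr_unitHom_mem_coind_iff.2 ha)), fun h _ => extend_mono h _⟩

theorem coind_mul_coind_le_coind_iff {I J P : TambaraIdeal R} :
    I.coind * J.coind ≤ P.coind ↔ I * J ≤ P := by
  rw [mul_le_iff, mul_le_iff]
  constructor
  · intro h L a ha b hb
    rw [← tr_unitHom_mem_coind_iff, R.tr_mul_of_injective (unitHom_injective L)]
    exact h _ _ (tr_unitHom_mem_coind_iff.2 ha) _ (tr_unitHom_mem_coind_iff.2 hb)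
  · intro h K a ha b hb
    refine mem_coind.2 fun L t => ?_
    exact (map_mul (R.res t) a b).symm ▸ h L _ (mem_coind.1 ha L t) _ (mem_coind.1 hb L t)

theorem coind_eq_top_iff {P : TambaraIdeal R} : P.coind = ⊤ ↔ P = ⊤ := by
  have htop : (⊤ : TambaraIdeal R).coind = ⊤ := by
    ext K a
    exact iff_of_true (mem_coind.2 fun _ _ => Submodule.mem_top) Submodule.mem_top
  rw [← htop]
  exact coindOrderIso.injective.eq_iff

theorem coind_bot : (⊥ : TambaraIdeal R).coind = ⊥ := by
  have hbot : (⊥ : TambaraIdeal (TambaraFunctor.coind H R)).ofCoind = ⊥ :=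
    TambaraIdeal.ext (funext fun _ => Ideal.map_bot)
  rw [← hbot, coind_ofCoind]

theorem isPrime_coind_iff {P : TambaraIdeal R} : P.coind.IsPrime ↔ P.IsPrime := by
  constructor
  · refine fun h => ⟨mt coind_eq_top_iff.2 h.ne_top, fun I J hIJ => ?_⟩
    exact (h.le_or_le _ _ (coind_mul_coind_le_coind_iff.2 hIJ)).imp
      coindOrderIso.le_iff_le.1 coindOrderIso.le_iff_le.1
  · refine fun h => ⟨mt coind_eq_top_iff.1 h.ne_top, fun I J hIJ => ?_⟩
    obtain ⟨I, rfl⟩ := coindOrderIso.surjective I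
    obtain ⟨J, rfl⟩ := coindOrderIso.surjective J
    exact (h.le_or_le _ _ (coind_mul_coind_le_coind_iff.1 hIJ)).imp
      coindOrderIso.le_iff_le.2 coindOrderIso.le_iff_le.2

end Coind

end TambaraIdeal

theorem mainTheorem12_general {G : Type u} [Group G] (H : Subgroup G) :
    (∀ (R : Type v) [CommRing R] [MulSemiringAction H R] (I : Ideal R),
      (∀ h : H, ∀ x ∈ I, h • x ∈ I) →
        (IsGPrime G (coindRing.coindIdeal H I) ↔ IsGPrime H I)) ∧
    (∀ [Finite G] (R : TambaraFunctor.{u, w} H) (P : TambaraIdeal R),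
      P.coind.IsPrime ↔ P.IsPrime) :=
  ⟨fun _ _ _ _ hI => ⟨coindRing.isGPrime_of_coindIdeal hI, coindRing.isGPrime_coindIdeal⟩,
    fun _ _ => TambaraIdeal.isPrime_coind_iff⟩

theorem mainTheorem12 {G : Type u} [Group G] [Finite G] (H : Subgroup G) :
    (∀ (R : Type v) [CommRing R] [MulSemiringAction H R],
      IsDomainLikeRing G (coindRing H R) ↔ IsDomainLikeRing H R) ∧
    (∀ R : TambaraFunctor.{u, w} H,
      (TambaraFunctor.coind H R).IsDomainLike ↔ R.IsDomainLike) := by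
  obtain ⟨hring, htambara⟩ := mainTheorem12_general H
  exact ⟨fun R _ _ => by simpa [IsDomainLikeRing, coindRing.coindIdeal_bot] using hring R ⊥,
    fun R => by
      simpa only [TambaraFunctor.IsDomainLike, TambaraIdeal.coind_bot] using htambara R ⊥⟩
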